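/- Let $K$ be an algebraic number field such that $-1$ is not a square in $K$, and let $n = 2^{\alpha}k$ with $\alpha \ge 2$ and $k$ odd. Then there exists a cyclic Galois extension $L/K$ of degree $n$ such that for every generator $\sigma$ of $G=\mathrm{Gal}(L/K)$ the following holds. Notation. $\mathrm{Sym}_K(L)$ is the $K$-space of symmetric $K$-bilinear forms $L\times L\to K$. For $b\in L$ and $\tau\in G$ let $\phi_{b,\tau}(x,y)=\mathrm{Tr}_{L/K}\bigl(b(x\tau(y)+\tau(x)y)\bigr)$. Put $A^i=\{\phi_{b,\sigma^i}: b\in L\}$ and $B^1=A^{n/2}$. An $r$-subspace of $\mathrm{Sym}_K(L)$ is a $K$-subspace all of whose nonzero elements have rank $r$. For $1\le i<n/2$ let $m_i=\mathrm{ord}(\sigma^i)=2^{\beta_i}k_i'$ with $k_i'$ odd. * If $m_i\equiv 2 \pmod 4$ and $m_i \neq 2$, put $\mathcal U_i=\{\phi_{b,\sigma^i}: \sigma^{ik_i'}(b)=b\}$ and $\mathcal V_i=\{\phi_{b,\sigma^i}: \sigma^{ik_i'}(b)=-b\}$. * If $m_i\equiv 0\pmod 4$, put $\mathcal V_1^i=\{\phi_{b,\sigma^i}: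 \sigma^{ik_i'}(b)=b\}$, $\mathcal V_2^i=\{\phi_{b,\sigma^i}: \sigma^{ik_i'}(b)=-b\}$ and, for $1\le j\le\beta_i-1$, $\mathcal E_j^i=\{\phi_{b,\sigma^i}: \sigma^{i m_i/2^j}(b)=-b\}$. Claim. There is a direct sum decomposition into $K$-subspaces $$\mathrm{Sym}_K(L)=B^1\oplus A^0\oplus\bigoplus_{\substack{m_i\equiv 2\,(4)\\ m_i\ne 2}}(\mathcal U_i\oplus\mathcal V_i)\oplus\bigoplus_{m_i\equiv 1\,(2)}A^i\oplus\bigoplus_{m_i\equiv 0\,(4)}\bigl(\mathcal V_1^i\oplus\mathcal V_2^i\oplus\mathcal E_1^i\oplus\cdots\oplus\mathcal E_{\beta_i-1}^i\bigr),$$ where $i$ runs over $1\le i<n/2$ in each sum. All summands have constant rank: $B^1$, $A^0$, $\mathcal U_i$, $A^i$ ($m_i$ odd) and $\mathcal E^i_j$ are $n$-subspaces of dimension $n/2$, $n$, $n/2$, $n$ and $n/2^j$ respectively; $\mathcal V_i$ is an $(n-2n/m_i)$-subspace of dimension $n/2$; and $\mathcal V_1^i,\mathcal V_2^i$ are $(n-2n/m_i)$-subspaces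 of dimension $k_i'n/m_i$. -/

import Mathlib

universe u

namespace GaloisSymForm

/-- The `K`-space of symmetric `K`-bilinear forms on a `K`-space `V`. -/
def Sym (K V : Type*) [Field K] [AddCommGroup V] [Module K V] :
    Submodule K (LinearMap.BilinForm K V) where
  carrier := {φ | φ.IsSymm}
  add_mem' := fun hφ hψ => hφ.add hψ
  zero_mem' := LinearMap.BilinForm.isSymm_zero
  smul_mem' := fun c _ hφ => hφ.smul c

/-- The rank of a symmetric bilinear form, i.e. the dimension of the image of `x ↦ φ(x, ·)`. -/
noncomputable def rank {K V : Type*} [Field K] [AddCommGroup V] [Module K V]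
    (φ : Sym K V) : ℕ :=
  Module.finrank K (LinearMap.range (φ : LinearMap.BilinForm K V))

/-- `W` is an `r`-subspace of `Sym K V`: all its nonzero elements have rank `r`. -/
def IsRankSubspace {K V : Type*} [Field K] [AddCommGroup V] [Module K V]
    (r : ℕ) (W : Submodule K (Sym K V)) : Prop :=
  ∀ φ ∈ W, φ ≠ 0 → rank φ = r

section

variable {K L : Type*} [Field K] [Field L] [Algebra K L]

/-- The symmetric bilinear form `(x, y) ↦ Tr_{L/K} (b (x σ(y) + σ(x) y))`. -/
noncomputable def form (s : L ≃ₐ[K] L) (b : L) : Sym K L :=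
  ⟨LinearMap.mk₂ K (fun x y => Algebra.trace K L (b * (x * s y + s x * y)))
      (fun x x' y => by rw [← map_add]; congr 1; rw [map_add]; ring)
      (fun c x y => by
        rw [← map_smul]; congr 1; rw [map_smul]; simp only [Algebra.smul_def]; ring)
      (fun x y y' => by rw [← map_add]; congr 1; rw [map_add]; ring)
      (fun c x y => by
        rw [← map_smul]; congr 1; rw [map_smul]; simp only [Algebra.smul_def]; ring),
    ⟨fun x y => by
      simp only [LinearMap.mk₂_apply]; congr 1; ring⟩⟩

/-- The `K`-linear map `b ↦ φ_{b,σ}` from `L` to the space of symmetric bilinear forms. -/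
noncomputable def formMap (s : L ≃ₐ[K] L) : L →ₗ[K] Sym K L where
  toFun := form s
  map_add' b c := by
    ext x y
    change Algebra.trace K L _ = Algebra.trace K L _ + Algebra.trace K L _
    rw [← map_add]; congr 1; ring
  map_smul' a b := by
    ext x y
    change Algebra.trace K L _ = a • Algebra.trace K L _
    rw [← map_smul]; congr 1; simp only [Algebra.smul_def]; ring

/-- `A^σ = {φ_{b,σ} : b ∈ L}`. -/
noncomputable def A (s : L ≃ₐ[K] L) : Submodule K (Sym K L) :=
  LinearMap.range (formMap s)

/-- The exponent `β` of `2` in the order of `s`. -/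
noncomputable def twoExp (s : L ≃ₐ[K] L) : ℕ := padicValNat 2 (orderOf s)

/-- The odd part `k'` of the order of `s`, so that `ord s = 2 ^ β * k'`. -/
noncomputable def oddPart (s : L ≃ₐ[K] L) : ℕ := orderOf s / 2 ^ twoExp s

/-- `{φ_{b,s} : b ∈ L, s^{k'}(b) = b}`, where `k'` is the odd part of the order of `s`. -/
noncomputable def plusSpace (s : L ≃ₐ[K] L) : Submodule K (Sym K L) :=
  (Module.End.eigenspace (s ^ oddPart s).toLinearMap (1 : K)).map (formMap s)

/-- `{φ_{b,s} : b ∈ L, s^{k'}(b) = -b}`, where `k'` is the odd part of the order of `s`. -/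
noncomputable def minusSpace (s : L ≃ₐ[K] L) : Submodule K (Sym K L) :=
  (Module.End.eigenspace (s ^ oddPart s).toLinearMap (-1 : K)).map (formMap s)

/-- `{φ_{b,s} : b ∈ L, s^{ord(s) / 2 ^ j}(b) = -b}`. -/
noncomputable def eSpace (s : L ≃ₐ[K] L) (j : ℕ) : Submodule K (Sym K L) :=
  (Module.End.eigenspace (s ^ (orderOf s / 2 ^ j)).toLinearMap (-1 : K)).map (formMap s)

/-- The summands of the decomposition of `Sym K L` for a cyclic extension of even degree `n` with
generator `σ`. Apart from `B` and `A0` they are labelled by an exponent `i` with `1 ≤ i < n / 2`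
(one from each pair `{σ^i, σ^{-i}}` of mutually inverse elements that are neither `1` nor the
involution `σ^{n/2}`), sorted by the order of `σ^i`. -/
inductive Index (σ : L ≃ₐ[K] L) (n : ℕ) : Type
  | B : Index σ n
  | A0 : Index σ n
  | U (i : ℕ) (hi : 1 ≤ i ∧ i < n / 2)
      (h : orderOf (σ ^ i) ≡ 2 [MOD 4] ∧ orderOf (σ ^ i) ≠ 2) : Index σ n
  | V (i : ℕ) (hi : 1 ≤ i ∧ i < n / 2)
      (h : orderOf (σ ^ i) ≡ 2 [MOD 4] ∧ orderOf (σ ^ i) ≠ 2) : Index σ n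
  | Aodd (i : ℕ) (hi : 1 ≤ i ∧ i < n / 2) (h : orderOf (σ ^ i) ≡ 1 [MOD 2]) : Index σ n
  | V1 (i : ℕ) (hi : 1 ≤ i ∧ i < n / 2) (h : orderOf (σ ^ i) ≡ 0 [MOD 4]) : Index σ n
  | V2 (i : ℕ) (hi : 1 ≤ i ∧ i < n / 2) (h : orderOf (σ ^ i) ≡ 0 [MOD 4]) : Index σ n
  | E (i : ℕ) (hi : 1 ≤ i ∧ i < n / 2) (h : orderOf (σ ^ i) ≡ 0 [MOD 4])
      (j : ℕ) (hj : 1 ≤ j ∧ j ≤ twoExp (σ ^ i) - 1) : Index σ n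

noncomputable instance Index.instDecidableEq (σ : L ≃ₐ[K] L) (n : ℕ) : DecidableEq (Index σ n) := Classical.decEq _

/-- The subspace of `Sym K L` carried by each label. -/
noncomputable def summand (σ : L ≃ₐ[K] L) (n : ℕ) : Index σ n → Submodule K (Sym K L)
  | .B => A (σ ^ (n / 2))
  | .A0 => A (σ ^ 0)
  | .U i _ _ => plusSpace (σ ^ i)
  | .V i _ _ => minusSpace (σ ^ i)
  | .Aodd i _ _ => A (σ ^ i)
  | .V1 i _ _ => plusSpace (σ ^ i)
  | .V2 i _ _ => minusSpace (σ ^ i)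
  | .E i _ _ j _ => eSpace (σ ^ i) j

/-- The common rank of the nonzero forms in each summand. -/
noncomputable def summandRank (σ : L ≃ₐ[K] L) (n : ℕ) : Index σ n → ℕ
  | .B => n
  | .A0 => n
  | .U _ _ _ => n
  | .V i _ _ => n - 2 * n / orderOf (σ ^ i)
  | .Aodd _ _ _ => n
  | .V1 i _ _ => n - 2 * n / orderOf (σ ^ i)
  | .V2 i _ _ => n - 2 * n / orderOf (σ ^ i)
  | .E _ _ _ _ _ => n

/-- The dimension over `K` of each summand. -/
noncomputable def summandDim (σ : L ≃ₐ[K] L) (n : ℕ) : Index σ n → ℕ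
  | .B => n / 2
  | .A0 => n
  | .U _ _ _ => n / 2
  | .V _ _ _ => n / 2
  | .Aodd _ _ _ => n
  | .V1 i _ _ => oddPart (σ ^ i) * n / orderOf (σ ^ i)
  | .V2 i _ _ => oddPart (σ ^ i) * n / orderOf (σ ^ i)
  | .E _ _ _ j _ => n / 2 ^ j

end

end GaloisSymForm

/-! Write `s` for a power of the generator. By nondegeneracy of the trace form, the radical of
`φ_{b,s}` is the solution space of `s²(x) = c x` with `c = -b / s(b)`. By a Hilbert 90 argument this
space is `0` unless the product of the translates of `c` under `⟨s²⟩` is `1`, and then it is a line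
over the fixed field of `s²`. So every nonzero form has rank `n` or `n - n / ord(s²)`, and each rank
claim reduces to computing one norm. If `s^q(b) = ±b` with `q` odd, the norm is an explicit sign.
For the spaces `𝓔_j`, norm `1` would make a certain quotient `s(Q)/Q` a root of unity of 2-power
order. If `-1` is not a square in `L`, that root is `±1`, which contradicts `s²(Q) = -Q`
(`orbitProd_neg_div_ne_one`).

For the decomposition, independence of automorphisms identifies bilinear forms with families of
coefficients indexed by the Galois group. Symmetric forms pair `g` with `g⁻¹`, so `Sym` is the
direct sum of the `A^i` with `0 ≤ i ≤ n/2`. For `0 < i < n/2` the map `b ↦ φ_{b,s}` is injective,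
and `t = s^{k'}` satisfies `t^{2^β} = 1`. Hence `L` splits into the kernels of `t - 1, t + 1, t² +
1, …, t^{2^{β-1}} + 1`, which give the listed summands.

It remains to find a cyclic `L` of degree `n` without a square root of `-1`. Take `p ≡ 1 (mod n)`
prime and larger than `|disc K(i)|`. Then `K(ζ_p)` does not contain `i`, and `L` is its subfield of
degree `n`. -/

namespace GaloisSymForm

/-! ### The equation `h(x) = c x` and Hilbert 90 -/

variable {K L : Type*} [Field K] [Field L] [Algebra K L]

/-- The `K`-subspace of solutions of the equation `h x = c x`. -/
def twistedFixed (h : L ≃ₐ[K] L) (c : L) : Submodule K L where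
  carrier := {x | h x = c * x}
  add_mem' {x y} hx hy := by
    simp only [Set.mem_ofPred_eq] at *
    rw [map_add, hx, hy, mul_add]
  zero_mem' := by simp
  smul_mem' a x hx := by
    simp only [Set.mem_ofPred_eq] at *
    rw [map_smul, hx, mul_smul_comm]

theorem mem_twistedFixed {h : L ≃ₐ[K] L} {c x : L} : x ∈ twistedFixed h c ↔ h x = c * x := Iff.rfl

theorem prod_pow_mul_of_mem_twistedFixed {h : L ≃ₐ[K] L} {c x : L} (hx : x ∈ twistedFixed h c)
    (r : ℕ) : (∏ j ∈ Finset.range r, (h ^ j) c) * x = (h ^ r) x := by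
  induction r with
  | zero => simp
  | succ r ih =>
    rw [Finset.prod_range_succ, mul_right_comm, ih, ← map_mul, mul_comm x c,
      ← mem_twistedFixed.mp hx, pow_succ, AlgEquiv.mul_apply]

/-- Iterating the equation around a full cycle of `h` multiplies a solution by the norm of `c` and
returns it unchanged. -/
theorem twistedFixed_eq_bot {h : L ≃ₐ[K] L} {c : L}
    (hc : ∏ j ∈ Finset.range (orderOf h), (h ^ j) c ≠ 1) : twistedFixed h c = ⊥ := by
  rw [eq_bot_iff]
  intro x hx
  rw [Submodule.mem_bot]
  by_contra hx0
  have := prod_pow_mul_of_mem_twistedFixed hx (orderOf h)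
  rw [pow_orderOf_eq_one, AlgEquiv.one_apply] at this
  exact hc (mul_right_cancel₀ hx0 (this.trans (one_mul x).symm))

theorem linearIndependent_algEquiv :
    LinearIndependent L (fun g : L ≃ₐ[K] L => (g.toLinearMap : L →ₗ[K] L)) :=
  (linearIndependent_toLinearMap K L L).comp (fun g : L ≃ₐ[K] L => (g : L →ₐ[K] L))
    AlgEquiv.coe_toAlgHom_injective

theorem exists_sum_smul_pow_ne_zero (h : L ≃ₐ[K] L) {r : ℕ} (hr : r ≤ orderOf h) (a : ℕ → L)
    {i : ℕ} (hi : i < r) (ha : a i ≠ 0) :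
    ∃ z : L, ∑ j ∈ Finset.range r, a j * (h ^ j) z ≠ 0 := by
  by_contra! H
  have hinj : Function.Injective (fun j : Fin r => h ^ (j : ℕ)) := fun j l hjl =>
    Fin.ext (pow_injOn_Iio_orderOf (j.2.trans_le hr) (l.2.trans_le hr) hjl)
  have hli := linearIndependent_algEquiv.comp _ hinj
  rw [Fintype.linearIndependent_iff] at hli
  refine ha (hli (fun j => a j) ?_ ⟨i, hi⟩)
  ext z
  simpa [Finset.sum_range, LinearMap.sum_apply] using H z

theorem exists_ne_zero_mem_twistedFixed {h : L ≃ₐ[K] L} (hfin : 0 < orderOf h) {c : L}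
    (hc : ∏ j ∈ Finset.range (orderOf h), (h ^ j) c = 1) :
    ∃ x ∈ twistedFixed h c, x ≠ 0 := by
  have hc0 : c ≠ 0 := by
    rintro rfl
    simp [hfin.ne'] at hc
  -- Coefficients of the Hilbert 90 resolvent `∑ a_j h^j(z)`: applying `h` shifts the index and
  -- pulls out `c`, and the sum closes up because norm `1` gives `a_{ord h} = a_0`.
  set a : ℕ → L := fun j => ∏ l ∈ Finset.range j, ((h ^ l) c)⁻¹ with ha
  have hstep : ∀ j, h (a j) = c * a (j + 1) := by
    intro j
    simp only [ha]
    rw [Finset.prod_range_succ', map_prod, mul_comm, mul_assoc]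
    simp only [map_inv₀, pow_zero, AlgEquiv.one_apply]
    rw [inv_mul_cancel₀ hc0, mul_one]
    refine Finset.prod_congr rfl fun l _ => ?_
    rw [pow_succ', AlgEquiv.mul_apply]
  have hlast : a (orderOf h) = 1 := by simp only [ha, Finset.prod_inv_distrib, hc, inv_one]
  have ha0 : a 0 = 1 := by simp [ha]
  obtain ⟨z, hz⟩ := exists_sum_smul_pow_ne_zero h le_rfl a hfin (by simp [ha0])
  refine ⟨_, ?_, hz⟩
  rw [mem_twistedFixed, map_sum, Finset.mul_sum]
  have h1 : ∀ j ∈ Finset.range (orderOf h),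
      h (a j * (h ^ j) z) = c * (a (j + 1) * (h ^ (j + 1)) z) := by
    intro j _
    rw [map_mul, hstep, pow_succ', AlgEquiv.mul_apply, mul_assoc]
  rw [Finset.sum_congr rfl h1, ← Finset.mul_sum, ← Finset.mul_sum]
  congr 1
  have h2 := Finset.sum_range_succ (fun j => a j * (h ^ j) z) (orderOf h)
  rw [Finset.sum_range_succ'] at h2
  simp only [hlast, ha0, pow_orderOf_eq_one, pow_zero] at h2
  exact add_right_cancel h2

theorem eigenspace_eq_twistedFixed (h : L ≃ₐ[K] L) (μ : K) :
    Module.End.eigenspace h.toLinearMap μ = twistedFixed h (algebraMap K L μ) := by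
  ext x
  rw [Module.End.mem_eigenspace_iff, mem_twistedFixed, Algebra.smul_def]
  rfl

variable [FiniteDimensional K L]

theorem finrank_twistedFixed_one (h : L ≃ₐ[K] L) :
    Module.finrank K (twistedFixed h 1) * orderOf h = Module.finrank K L := by
  have h1 : twistedFixed h 1 =
      (IntermediateField.fixedField (Subgroup.zpowers h)).toSubalgebra.toSubmodule := by
    ext x
    rw [mem_twistedFixed, one_mul, Subalgebra.mem_toSubmodule,
      IntermediateField.mem_toSubalgebra, IntermediateField.mem_fixedField_iff]
    constructor
    · rintro hx f ⟨k, rfl⟩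
      have : h ∈ MulAction.stabilizer (L ≃ₐ[K] L) x := hx
      exact (MulAction.stabilizer (L ≃ₐ[K] L) x).zpow_mem this k
    · intro hx
      exact hx h (Subgroup.mem_zpowers h)
  rw [h1, ← Nat.card_zpowers h, ← IntermediateField.finrank_fixedField_eq_card]
  exact Module.finrank_mul_finrank K (IntermediateField.fixedField (Subgroup.zpowers h)) L

/-- Multiplication by one nonzero solution carries the fixed field of `h` onto the solution space.
-/
theorem finrank_twistedFixed {h : L ≃ₐ[K] L} {c : L}
    (hc : ∏ j ∈ Finset.range (orderOf h), (h ^ j) c = 1) :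
    Module.finrank K (twistedFixed h c) * orderOf h = Module.finrank K L := by
  obtain ⟨y, hy, hy0⟩ := exists_ne_zero_mem_twistedFixed (orderOf_pos h) hc
  rw [← finrank_twistedFixed_one h]
  congr 1
  have hc0 : c ≠ 0 := by
    rintro rfl
    simp [(orderOf_pos h).ne'] at hc
  have : twistedFixed h c = (twistedFixed h 1).map (LinearMap.mulLeft K y) := by
    ext x
    rw [Submodule.mem_map, mem_twistedFixed]
    rw [mem_twistedFixed] at hy
    constructor
    · intro hx
      refine ⟨y⁻¹ * x, ?_, ?_⟩
      · rw [mem_twistedFixed, map_mul, map_inv₀, hx, hy]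
        field_simp
      · simp [hy0]
    · rintro ⟨z, hz, rfl⟩
      rw [mem_twistedFixed, one_mul] at hz
      simp only [LinearMap.mulLeft_apply, map_mul, hy, hz, mul_assoc]
  rw [this]
  exact (Submodule.equivMapOfInjective _ (mul_right_injective₀ hy0) _).finrank_eq.symm

theorem finrank_eigenspace_one (h : L ≃ₐ[K] L) :
    Module.finrank K (Module.End.eigenspace h.toLinearMap (1 : K)) * orderOf h
      = Module.finrank K L := by
  rw [eigenspace_eq_twistedFixed, map_one, finrank_twistedFixed_one]

theorem finrank_eigenspace_neg_one {h : L ≃ₐ[K] L} (hh : Even (orderOf h)) :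
    Module.finrank K (Module.End.eigenspace h.toLinearMap (-1 : K)) * orderOf h
      = Module.finrank K L := by
  rw [eigenspace_eq_twistedFixed, map_neg, map_one, finrank_twistedFixed]
  simp [hh.neg_one_pow]

end GaloisSymForm

/-! ### Radicals, norms and ranks of single forms -/

namespace GaloisSymForm

variable {K L : Type*} [Field K] [Field L] [Algebra K L]

theorem form_apply (s : L ≃ₐ[K] L) (b x y : L) :
    (form s b : LinearMap.BilinForm K L) x y
      = Algebra.trace K L ((s.symm (b * x) + b * s x) * y) := by
  change Algebra.trace K L (b * (x * s y + s x * y)) = _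
  have h1 : Algebra.trace K L (b * (x * s y)) = Algebra.trace K L (s.symm (b * x) * y) := by
    rw [← Algebra.trace_eq_of_algEquiv s (s.symm (b * x) * y), map_mul s, AlgEquiv.apply_symm_apply,
      mul_assoc]
  rw [mul_add, map_add, h1, add_mul, map_add, mul_assoc b]

theorem formMap_apply (s : L ≃ₐ[K] L) (b : L) : formMap s b = form s b := rfl

/-- The product of the translates of `b` by the powers of `h`. -/
noncomputable def orbitProd (h : L ≃ₐ[K] L) (b : L) : L :=
  ∏ j ∈ Finset.range (orderOf h), (h ^ j) b

theorem apply_prod_range_pow (h : L ≃ₐ[K] L) (b : L) (r : ℕ) :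
    h (∏ j ∈ Finset.range r, (h ^ j) b) * b = (h ^ r) b * ∏ j ∈ Finset.range r, (h ^ j) b := by
  rw [map_prod]
  have h2 := Finset.prod_range_succ (fun j => (h ^ j) b) r
  rw [Finset.prod_range_succ', pow_zero, AlgEquiv.one_apply] at h2
  rw [mul_comm ((h ^ r) b), ← h2]
  simp only [pow_succ', AlgEquiv.mul_apply]

theorem orbitProd_ne_zero (h : L ≃ₐ[K] L) {b : L} (hb : b ≠ 0) : orbitProd h b ≠ 0 :=
  Finset.prod_ne_zero_iff.mpr fun j _ => (map_ne_zero_iff _ (h ^ j).injective).mpr hb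

theorem apply_orbitProd (h : L ≃ₐ[K] L) {b : L} (hb : b ≠ 0) : h (orbitProd h b) = orbitProd h b := by
  have := apply_prod_range_pow h b (orderOf h)
  rw [pow_orderOf_eq_one, AlgEquiv.one_apply, mul_comm b] at this
  exact mul_right_cancel₀ hb this

theorem pow_apply_eq_self {h : L ≃ₐ[K] L} {x : L} (hx : h x = x) (r : ℕ) : (h ^ r) x = x := by
  induction r with
  | zero => simp
  | succ r ih => rw [pow_succ, AlgEquiv.mul_apply, hx, ih]

theorem orbitProd_commute {h t : L ≃ₐ[K] L} (hc : Commute t h) (b : L) :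
    t (orbitProd h b) = orbitProd h (t b) := by
  simp only [orbitProd, map_prod]
  refine Finset.prod_congr rfl fun j _ => ?_
  rw [← AlgEquiv.mul_apply, (hc.pow_right j).eq, AlgEquiv.mul_apply]

theorem orbitProd_neg_div (s : L ≃ₐ[K] L) (b : L) :
    orbitProd (s ^ 2) (-(b / s b))
      = (-1) ^ orderOf (s ^ 2) * (orbitProd (s ^ 2) b / s (orbitProd (s ^ 2) b)) := by
  rw [orbitProd_commute ((Commute.refl s).pow_right 2)]
  simp only [orbitProd, map_neg, map_div₀, Finset.prod_neg, Finset.prod_div_distrib,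
    Finset.card_range]

/-- For odd `q`, `s · s^q` is a power of `s²`, which fixes the orbit product of `s²`. -/
theorem apply_orbitProd_sq {s : L ≃ₐ[K] L} {q : ℕ} (hq : Odd q) {b : L} (hb : b ≠ 0) :
    s (orbitProd (s ^ 2) ((s ^ q) b)) = orbitProd (s ^ 2) b := by
  obtain ⟨p, rfl⟩ := hq
  rw [← orbitProd_commute ((Commute.refl s).pow_pow _ _), ← AlgEquiv.mul_apply, ← pow_succ',
    show 2 * p + 1 + 1 = 2 * (p + 1) by ring, pow_mul]
  exact pow_apply_eq_self (apply_orbitProd _ hb) _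

theorem orbitProd_neg_div_of_fixed {s : L ≃ₐ[K] L} {q : ℕ} (hq : Odd q) {b : L} (hb : b ≠ 0)
    (hfix : (s ^ q) b = b) :
    orbitProd (s ^ 2) (-(b / s b)) = (-1) ^ orderOf (s ^ 2) := by
  have h1 := apply_orbitProd_sq (s := s) hq hb
  rw [hfix] at h1
  rw [orbitProd_neg_div, h1, div_self (orbitProd_ne_zero _ hb), mul_one]

theorem orbitProd_neg (h : L ≃ₐ[K] L) (b : L) :
    orbitProd h (-b) = (-1) ^ orderOf h * orbitProd h b := by
  simp only [orbitProd, map_neg, Finset.prod_neg, Finset.card_range]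

theorem orbitProd_neg_div_of_neg {s : L ≃ₐ[K] L} {q : ℕ} (hq : Odd q) {b : L} (hb : b ≠ 0)
    (hneg : (s ^ q) b = -b) :
    orbitProd (s ^ 2) (-(b / s b)) = 1 := by
  have h1 := apply_orbitProd_sq (s := s) hq hb
  have h0 := orbitProd_ne_zero (s ^ 2) hb
  have h2 : s (orbitProd (s ^ 2) b) ≠ 0 := by simpa using h0
  rw [hneg, orbitProd_neg, map_mul, map_pow, map_neg, map_one] at h1
  have h3 : orbitProd (s ^ 2) b / s (orbitProd (s ^ 2) b) = (-1) ^ orderOf (s ^ 2) := by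
    rw [div_eq_iff h2, h1]
  rw [orbitProd_neg_div, h3, ← pow_add, Even.neg_one_pow ⟨_, rfl⟩]

theorem eq_one_or_eq_neg_one_of_pow_two_pow_eq_one (hL : ¬ IsSquare (-1 : L)) (j : ℕ) {z : L}
    (hz : z ^ 2 ^ j = 1) : z = 1 ∨ z = -1 := by
  induction j generalizing z with
  | zero => left; simpa using hz
  | succ j ih =>
    rw [pow_succ', pow_mul] at hz
    rcases ih hz with h | h
    · exact mul_self_eq_one_iff.mp (by rw [← sq, h])
    · exact absurd ⟨z, by rw [← h, sq]⟩ hL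

/-- This is the rank statement for `𝓔_j`, and the only rank computation that needs `-1` to be a
nonsquare in `L`. -/
theorem orbitProd_neg_div_ne_one (hL : ¬ IsSquare (-1 : L)) {s : L ≃ₐ[K] L} {e j : ℕ}
    (hord : orderOf (s ^ 2) = e * 2 ^ j) (hj : 1 ≤ j) (h2 : (2 : L) ≠ 0) {b : L} (hb : b ≠ 0)
    (hneg : (s ^ (2 * e)) b = -b) :
    orbitProd (s ^ 2) (-(b / s b)) ≠ 1 := by
  set h := s ^ 2 with hh
  have hneg' : (h ^ e) b = -b := by rw [hh, ← pow_mul, hneg]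
  -- The product over the first `e` translates. One application of `h` replaces the factor `b` by
  -- `h^e(b) = -b`, so `h(Q) = -Q`.
  set Q := ∏ l ∈ Finset.range e, (h ^ l) b with hQ
  have hQ0 : Q ≠ 0 := Finset.prod_ne_zero_iff.mpr fun l _ => (map_ne_zero_iff _ (h ^ l).injective).mpr hb
  have hhQ : h Q = -Q := by
    have := apply_prod_range_pow h b e
    rw [hneg', neg_mul, mul_comm b, ← neg_mul] at this
    exact mul_right_cancel₀ hb this
  have heQ : (h ^ e) Q = (-1) ^ e * Q := by
    rw [hQ, map_prod]
    have : ∀ l ∈ Finset.range e, (h ^ e) ((h ^ l) b) = -(h ^ l) b := fun l _ => by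
      rw [← AlgEquiv.mul_apply, ← pow_add, add_comm, pow_add, AlgEquiv.mul_apply, hneg', map_neg]
    rw [Finset.prod_congr rfl this, Finset.prod_neg, Finset.card_range]
  have haQ : ∀ a : ℕ, ((h ^ e) ^ a) Q = ((-1) ^ e) ^ a * Q := by
    intro a
    induction a with
    | zero => simp
    | succ a ih =>
      rw [pow_succ, AlgEquiv.mul_apply, heQ, map_mul, ih, pow_succ]
      simp only [map_pow, map_neg, map_one]
      ring
  -- Cutting the orbit into blocks of length `e` makes the orbit product a sign times `Q^{2^j}`; the
  -- sign is fixed by `s` and cancels below.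
  have hP : ∀ N : ℕ, ∏ l ∈ Finset.range (e * N), (h ^ l) b
      = (∏ a ∈ Finset.range N, ((-1) ^ e) ^ a) * Q ^ N := by
    intro N
    induction N with
    | zero => simp
    | succ N ih =>
      rw [mul_add, mul_one, Finset.prod_range_add, ih, Finset.prod_range_succ]
      have : ∏ x ∈ Finset.range e, (h ^ (e * N + x)) b = ((h ^ e) ^ N) Q := by
        rw [hQ, map_prod]
        refine Finset.prod_congr rfl fun l _ => ?_
        rw [pow_add, pow_mul, AlgEquiv.mul_apply]
      rw [this, haQ]
      ring
  have hev : Even (orderOf h) := by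
    rw [hord]
    exact (Nat.even_pow.mpr ⟨even_two, by lia⟩).mul_left _
  have hP0 := orbitProd_ne_zero h hb
  intro H
  rw [hh, orbitProd_neg_div, ← hh, hev.neg_one_pow, one_mul] at H
  have hsP : s (orbitProd h b) ≠ 0 := by simpa using hP0
  rw [div_eq_one_iff_eq hsP] at H
  simp only [orbitProd, hord] at H hP0
  rw [hP] at H hP0
  simp only [map_mul, map_pow, map_prod, map_neg, map_one] at H
  have hz : (s Q / Q) ^ 2 ^ j = 1 := by
    rw [div_pow, div_eq_one_iff_eq (pow_ne_zero _ hQ0)]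
    exact (mul_left_cancel₀ (left_ne_zero_of_mul hP0) H).symm
  have hssQ : h Q = s (s Q) := by rw [hh, sq, AlgEquiv.mul_apply]
  have hhQ' : h Q = Q := by
    rcases eq_one_or_eq_neg_one_of_pow_two_pow_eq_one hL j hz with h1 | h1
    · rw [div_eq_iff hQ0, one_mul] at h1
      rw [hssQ, h1, h1]
    · rw [div_eq_iff hQ0, neg_one_mul] at h1
      rw [hssQ, h1, map_neg, h1, neg_neg]
  rw [hhQ'] at hhQ
  have : (2 : L) * Q = 0 := by linear_combination hhQ
  exact (mul_ne_zero h2 hQ0) this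

variable [FiniteDimensional K L] [IsGalois K L]

theorem form_apply_eq_zero_iff (s : L ≃ₐ[K] L) (b x : L) :
    (form s b : LinearMap.BilinForm K L) x = 0 ↔ b * x + s b * s (s x) = 0 := by
  have h1 : (form s b : LinearMap.BilinForm K L) x = 0 ↔ s.symm (b * x) + b * s x = 0 := by
    constructor
    · intro h
      refine (traceForm_nondegenerate K L).1 _ fun y => ?_
      rw [Algebra.traceForm_apply, ← form_apply, h, LinearMap.zero_apply]
    · intro h
      ext y
      rw [form_apply, h, zero_mul, map_zero, LinearMap.zero_apply]
  rw [h1, ← map_eq_zero_iff s s.injective, map_add, AlgEquiv.apply_symm_apply, map_mul]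

theorem form_eq_zero_iff {s : L ≃ₐ[K] L} {b : L} :
    form s b = 0 ↔ ∀ x, b * x + s b * s (s x) = 0 := by
  simp only [← form_apply_eq_zero_iff, Subtype.ext_iff, LinearMap.ext_iff]
  rfl

/-- Evaluating the radical equation at `x = 1` gives `s(b) = -b`; it then reads `b x = b s²(x)` for
all `x`. -/
theorem formMap_injective {s : L ≃ₐ[K] L} (hs : s ^ 2 ≠ 1) : Function.Injective (formMap s) := by
  rw [injective_iff_map_eq_zero]
  intro b hb
  rw [formMap_apply, form_eq_zero_iff] at hb
  by_contra hb0
  refine hs (AlgEquiv.ext fun x => ?_)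
  have h1 := hb 1
  rw [map_one, map_one, mul_one, mul_one] at h1
  have hx := hb x
  rw [eq_neg_of_add_eq_zero_right h1, neg_mul, ← sub_eq_add_neg, sub_eq_zero] at hx
  rw [sq, AlgEquiv.mul_apply, AlgEquiv.one_apply, ← mul_left_cancel₀ hb0 hx]

theorem rank_form_add (s : L ≃ₐ[K] L) {b : L} (hb : b ≠ 0) :
    rank (form s b) + Module.finrank K (twistedFixed (s ^ 2) (-(b / s b)))
      = Module.finrank K L := by
  have : twistedFixed (s ^ 2) (-(b / s b))
      = LinearMap.ker (form s b : LinearMap.BilinForm K L) := by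
    ext x
    have hsb : s b ≠ 0 := by simpa using hb
    rw [LinearMap.mem_ker, form_apply_eq_zero_iff, mem_twistedFixed, sq, AlgEquiv.mul_apply,
      neg_mul, eq_neg_iff_add_eq_zero, div_mul_eq_mul_div, add_comm]
    constructor
    · intro h
      field_simp at h
      simpa using h
    · intro h
      field_simp
      simpa using h
  rw [this, rank]
  exact LinearMap.finrank_range_add_finrank_ker _

theorem rank_form_eq_finrank {s : L ≃ₐ[K] L} {b : L} (hb : b ≠ 0)
    (h : orbitProd (s ^ 2) (-(b / s b)) ≠ 1) : rank (form s b) = Module.finrank K L := by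
  have := rank_form_add s hb
  rwa [twistedFixed_eq_bot h, finrank_bot, add_zero] at this

theorem rank_form_eq_finrank_sub {s : L ≃ₐ[K] L} {b : L} (hb : b ≠ 0)
    (h : orbitProd (s ^ 2) (-(b / s b)) = 1) (hs : Even (orderOf s)) :
    rank (form s b) = Module.finrank K L - 2 * Module.finrank K L / orderOf s := by
  have h1 := rank_form_add s hb
  have h2 := finrank_twistedFixed h
  have h3 : orderOf s = 2 * orderOf (s ^ 2) := by
    rw [orderOf_pow_of_dvd two_ne_zero hs.two_dvd, Nat.mul_div_cancel' hs.two_dvd]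
  rw [h3, Nat.mul_div_mul_left _ _ two_pos]
  have h4 : Module.finrank K L / orderOf (s ^ 2)
      = Module.finrank K (twistedFixed (s ^ 2) (-(b / s b))) := by
    rw [← h2, Nat.mul_div_cancel _ (orderOf_pos _)]
  lia

end GaloisSymForm

/-! ### Ranks and dimensions of the summands -/

namespace GaloisSymForm

variable {K L : Type*} [Field K] [Field L] [Algebra K L]

noncomputable instance Sym.instAddCommGroup : AddCommGroup (Sym K L) :=
  Module.addCommMonoidToAddCommGroup K

theorem two_pow_twoExp_mul_oddPart (s : L ≃ₐ[K] L) : 2 ^ twoExp s * oddPart s = orderOf s :=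
  Nat.mul_div_cancel' pow_padicValNat_dvd

theorem mem_eigenspace_one_iff {t : L ≃ₐ[K] L} {b : L} :
    b ∈ Module.End.eigenspace t.toLinearMap (1 : K) ↔ t b = b := by
  rw [eigenspace_eq_twistedFixed, mem_twistedFixed, map_one, one_mul]

theorem mem_eigenspace_neg_one_iff {t : L ≃ₐ[K] L} {b : L} :
    b ∈ Module.End.eigenspace t.toLinearMap (-1 : K) ↔ t b = -b := by
  rw [eigenspace_eq_twistedFixed, mem_twistedFixed, map_neg, map_one, neg_one_mul]

theorem isRankSubspace_map_formMap {s : L ≃ₐ[K] L} {r : ℕ} {W : Submodule K L}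
    (h : ∀ b ∈ W, b ≠ 0 → form s b ≠ 0 → rank (form s b) = r) :
    IsRankSubspace r (W.map (formMap s)) := by
  rintro _ ⟨b, hb, rfl⟩ h0
  refine h b hb ?_ h0
  rintro rfl
  exact h0 (map_zero (formMap s))

theorem A_eq_map_top (s : L ≃ₐ[K] L) : A s = (⊤ : Submodule K L).map (formMap s) :=
  LinearMap.range_eq_map _

theorem A_eq_plusSpace {s : L ≃ₐ[K] L} (hs : s ^ oddPart s = 1) : A s = plusSpace s := by
  rw [A_eq_map_top, plusSpace, hs]
  congr 1
  refine (eq_top_iff.mpr fun x _ => ?_).symm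
  rw [mem_eigenspace_one_iff, AlgEquiv.one_apply]

theorem oddPart_eq_orderOf {s : L ≃ₐ[K] L} (hs : Odd (orderOf s)) : oddPart s = orderOf s := by
  have h : twoExp s = 0 := padicValNat.eq_zero_of_not_dvd fun h => by
    have := hs.not_two_dvd_nat
    exact this h
  simp [oddPart, h]

theorem orderOf_sq_of_even {s : L ≃ₐ[K] L} (hs : Even (orderOf s)) :
    orderOf s = 2 * orderOf (s ^ 2) := by
  rw [orderOf_pow_of_dvd two_ne_zero hs.two_dvd, Nat.mul_div_cancel' hs.two_dvd]

theorem finrank_A_of_injective {s : L ≃ₐ[K] L} (hs : Function.Injective (formMap s)) :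
    Module.finrank K (A s) = Module.finrank K L :=
  LinearMap.finrank_range_of_inj hs

theorem pow_sq_ne_one {σ : L ≃ₐ[K] L} {n : ℕ} (hσ : orderOf σ = n) {i : ℕ} (hi : 1 ≤ i ∧ i < n / 2) :
    (σ ^ i) ^ 2 ≠ 1 := by
  rw [← pow_mul]
  intro h
  have := Nat.le_of_dvd (by lia) (orderOf_dvd_of_pow_eq_one h)
  lia

theorem orderOf_pow_half {σ : L ≃ₐ[K] L} {n : ℕ} (hσ : orderOf σ = n) (h2 : 2 ∣ n) (hn0 : 0 < n) :
    orderOf (σ ^ (n / 2)) = 2 := by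
  rw [orderOf_pow_of_dvd (by lia) (by rw [hσ]; exact Nat.div_dvd_of_dvd h2), hσ, Nat.div_div_self h2 hn0.ne']

variable [FiniteDimensional K L]

theorem odd_oddPart (s : L ≃ₐ[K] L) : Odd (oddPart s) := by
  rw [← Nat.not_even_iff_odd, even_iff_two_dvd]
  rintro ⟨c, hc⟩
  refine pow_succ_padicValNat_not_dvd (p := 2) (orderOf_pos s).ne' ⟨c, ?_⟩
  change orderOf s = 2 ^ (twoExp s + 1) * c
  rw [← two_pow_twoExp_mul_oddPart s, hc, pow_succ, mul_assoc]

theorem orderOf_pow_oddPart (s : L ≃ₐ[K] L) : orderOf (s ^ oddPart s) = 2 ^ twoExp s := by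
  have h := two_pow_twoExp_mul_oddPart s
  have h0 : oddPart s ≠ 0 := (odd_oddPart s).pos.ne'
  rw [orderOf_pow_of_dvd h0 ⟨_, by rw [mul_comm, h]⟩, ← h,
    Nat.mul_div_cancel _ (Nat.pos_of_ne_zero h0)]

theorem twoExp_eq_one {s : L ≃ₐ[K] L} (hs : orderOf s ≡ 2 [MOD 4]) : twoExp s = 1 := by
  have h := two_pow_twoExp_mul_oddPart s
  obtain ⟨c, hc⟩ := odd_oddPart s
  rw [hc] at h
  unfold Nat.ModEq at hs
  rcases Nat.lt_or_ge (twoExp s) 2 with h2 | h2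
  · interval_cases h3 : twoExp s <;> lia
  · obtain ⟨d, hd⟩ := Nat.exists_eq_add_of_le h2
    rw [hd, pow_add, mul_assoc] at h
    lia

theorem two_le_twoExp {s : L ≃ₐ[K] L} (hs : orderOf s ≡ 0 [MOD 4]) : 2 ≤ twoExp s := by
  have h := two_pow_twoExp_mul_oddPart s
  obtain ⟨c, hc⟩ := odd_oddPart s
  rw [hc] at h
  unfold Nat.ModEq at hs
  by_contra! h2
  interval_cases h3 : twoExp s <;> lia

theorem finrank_map_eigenspace_one {s : L ≃ₐ[K] L} (hs : Function.Injective (formMap s))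
    (t : L ≃ₐ[K] L) :
    Module.finrank K ((Module.End.eigenspace t.toLinearMap (1 : K)).map (formMap s))
      = Module.finrank K L / orderOf t := by
  rw [← (Submodule.equivMapOfInjective _ hs _).finrank_eq, ← finrank_eigenspace_one t,
    Nat.mul_div_cancel _ (orderOf_pos t)]

theorem finrank_map_eigenspace_neg_one {s : L ≃ₐ[K] L} (hs : Function.Injective (formMap s))
    {t : L ≃ₐ[K] L} (ht : Even (orderOf t)) :
    Module.finrank K ((Module.End.eigenspace t.toLinearMap (-1 : K)).map (formMap s))
      = Module.finrank K L / orderOf t := by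
  rw [← (Submodule.equivMapOfInjective _ hs _).finrank_eq, ← finrank_eigenspace_neg_one ht,
    Nat.mul_div_cancel _ (orderOf_pos t)]

variable [IsGalois K L]

theorem form_eq_zero_iff_of_sq_eq_one {s : L ≃ₐ[K] L} (hs : s ^ 2 = 1) {b : L} :
    form s b = 0 ↔ s b = -b := by
  rw [form_eq_zero_iff]
  have h : ∀ x, s (s x) = x := fun x => by rw [← AlgEquiv.mul_apply, ← sq, hs, AlgEquiv.one_apply]
  simp only [h]
  refine ⟨fun H => ?_, fun H x => by rw [H]; ring⟩
  have := H 1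
  linear_combination this

/-- Here the norm of `c` is `c` itself, and `c = 1` means `s(b) = -b`, which makes the form zero. -/
theorem isRankSubspace_A_of_sq_eq_one {s : L ≃ₐ[K] L} (hs : s ^ 2 = 1) :
    IsRankSubspace (Module.finrank K L) (A s) := by
  rw [A_eq_map_top]
  refine isRankSubspace_map_formMap fun b _ hb hf => rank_form_eq_finrank hb fun h => hf ?_
  have hsb : s b ≠ 0 := by simpa using hb
  rw [hs, orbitProd, orderOf_one, Finset.prod_range_one, pow_zero, AlgEquiv.one_apply, ← neg_div,
    div_eq_one_iff_eq hsb] at h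
  rw [form_eq_zero_iff_of_sq_eq_one hs, h]

theorem isRankSubspace_plusSpace_of_odd [CharZero K] {s : L ≃ₐ[K] L} (hs : Odd (orderOf (s ^ 2))) :
    IsRankSubspace (Module.finrank K L) (plusSpace s) := by
  have : CharZero L := charZero_of_injective_algebraMap (algebraMap K L).injective
  refine isRankSubspace_map_formMap fun b hb hb0 _ => rank_form_eq_finrank hb0 ?_
  rw [orbitProd_neg_div_of_fixed (odd_oddPart s) hb0 (mem_eigenspace_one_iff.mp hb), hs.neg_one_pow]
  norm_num

theorem isRankSubspace_plusSpace_of_even {s : L ≃ₐ[K] L} (hs : orderOf s ≡ 0 [MOD 4]) :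
    IsRankSubspace (Module.finrank K L - 2 * Module.finrank K L / orderOf s) (plusSpace s) := by
  have hs4 : 4 ∣ orderOf s := Nat.modEq_zero_iff_dvd.mp hs
  have hev : Even (orderOf s) := even_iff_two_dvd.mpr (dvd_trans (by norm_num) hs4)
  refine isRankSubspace_map_formMap fun b hb hb0 _ => rank_form_eq_finrank_sub hb0 ?_ hev
  rw [orbitProd_neg_div_of_fixed (odd_oddPart s) hb0 (mem_eigenspace_one_iff.mp hb)]
  have := orderOf_sq_of_even hev
  refine Even.neg_one_pow (even_iff_two_dvd.mpr ?_)
  lia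

theorem isRankSubspace_minusSpace {s : L ≃ₐ[K] L} (hev : Even (orderOf s)) :
    IsRankSubspace (Module.finrank K L - 2 * Module.finrank K L / orderOf s) (minusSpace s) := by
  refine isRankSubspace_map_formMap fun b hb hb0 _ => rank_form_eq_finrank_sub hb0 ?_ hev
  exact orbitProd_neg_div_of_neg (odd_oddPart s) hb0 (mem_eigenspace_neg_one_iff.mp hb)

theorem isRankSubspace_eSpace [CharZero K] (hL : ¬ IsSquare (-1 : L)) {s : L ≃ₐ[K] L} {j : ℕ}
    (hj : 1 ≤ j ∧ j ≤ twoExp s - 1) :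
    IsRankSubspace (Module.finrank K L) (eSpace s j) := by
  have : CharZero L := charZero_of_injective_algebraMap (algebraMap K L).injective
  -- The bound `j ≤ β - 1` makes `ord(s) / 2^j` even, equal to `2e` with `e = 2^d k'`, so that
  -- `ord(s²) = e 2^j`.
  obtain ⟨d, hd⟩ := Nat.exists_eq_add_of_le (show j + 1 ≤ twoExp s by lia)
  have h1 := two_pow_twoExp_mul_oddPart s
  have h2 : orderOf s = 2 * (2 ^ d * oddPart s * 2 ^ j) := by
    rw [← h1, hd]; ring
  have hev : Even (orderOf s) := by rw [h2]; exact even_two_mul _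
  have h3 : orderOf s / 2 ^ j = 2 * (2 ^ d * oddPart s) := by
    rw [h2, ← mul_assoc, Nat.mul_div_cancel _ (by positivity)]
  have h4 := orderOf_sq_of_even hev
  refine isRankSubspace_map_formMap fun b hb hb0 _ => rank_form_eq_finrank hb0 ?_
  rw [h3, mem_eigenspace_neg_one_iff] at hb
  exact orbitProd_neg_div_ne_one hL (by lia) hj.1 two_ne_zero hb0 hb

theorem formMap_one_injective [CharZero K] : Function.Injective (formMap (1 : L ≃ₐ[K] L)) := by
  have : CharZero L := charZero_of_injective_algebraMap (algebraMap K L).injective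
  rw [injective_iff_map_eq_zero]
  intro b hb
  rw [formMap_apply, form_eq_zero_iff_of_sq_eq_one (one_pow 2), AlgEquiv.one_apply,
    self_eq_neg] at hb
  exact hb

theorem finrank_A_of_orderOf_eq_two {s : L ≃ₐ[K] L} (hs : orderOf s = 2) :
    Module.finrank K (A s) = Module.finrank K L / 2 := by
  have h2 : s ^ 2 = 1 := by rw [← hs, pow_orderOf_eq_one]
  have h1 : LinearMap.ker (formMap s) = Module.End.eigenspace s.toLinearMap (-1 : K) := by
    ext b
    rw [LinearMap.mem_ker, formMap_apply, form_eq_zero_iff_of_sq_eq_one h2,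
      mem_eigenspace_neg_one_iff]
  have h3 := finrank_eigenspace_neg_one (h := s) (by rw [hs]; exact even_two)
  have h4 := LinearMap.finrank_range_add_finrank_ker (V₂ := Sym K L) (formMap s)
  rw [h1] at h4
  rw [hs] at h3
  change Module.finrank K (LinearMap.range (formMap s)) = _
  lia

variable {σ : L ≃ₐ[K] L} {n : ℕ}

theorem isRankSubspace_summand [CharZero K] (hL : ¬ IsSquare (-1 : L))
    (hσ : orderOf σ = n) (hn : Module.finrank K L = n) (h2 : 2 ∣ n) (ι : Index σ n) :
    IsRankSubspace (summandRank σ n ι) (summand σ n ι) := by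
  have hn0 : 0 < n := hσ ▸ orderOf_pos σ
  cases ι with
  | B =>
    have := pow_orderOf_eq_one (σ ^ (n / 2))
    rw [orderOf_pow_half hσ h2 hn0] at this
    have h5 := isRankSubspace_A_of_sq_eq_one this
    rwa [hn] at h5
  | A0 =>
    rw [← hn]
    exact isRankSubspace_A_of_sq_eq_one (by simp)
  | U i hi h =>
    have h3 := h.1
    unfold Nat.ModEq at h3
    have h4 := orderOf_sq_of_even (s := σ ^ i) (even_iff_two_dvd.mpr (by lia))
    have h5 := isRankSubspace_plusSpace_of_odd (s := σ ^ i) (Nat.odd_iff.mpr (by lia))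
    rwa [hn] at h5
  | V i hi h =>
    have h3 := h.1
    unfold Nat.ModEq at h3
    have h5 := isRankSubspace_minusSpace (s := σ ^ i) (even_iff_two_dvd.mpr (by lia))
    rwa [hn] at h5
  | Aodd i hi h =>
    have h3 : Odd (orderOf (σ ^ i)) := Nat.odd_iff.mpr h
    have h4 : Odd (orderOf ((σ ^ i) ^ 2)) := by
      rwa [Nat.Coprime.orderOf_pow h3.coprime_two_right]
    have h5 := isRankSubspace_plusSpace_of_odd h4
    -- For odd order the condition `s^{k'}(b) = b` is vacuous.
    rw [hn, ← A_eq_plusSpace (by rw [oddPart_eq_orderOf h3, pow_orderOf_eq_one])] at h5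
    exact h5
  | V1 i hi h =>
    have h5 := isRankSubspace_plusSpace_of_even h
    rwa [hn] at h5
  | V2 i hi h =>
    have h3 := h
    unfold Nat.ModEq at h3
    have h5 := isRankSubspace_minusSpace (s := σ ^ i) (even_iff_two_dvd.mpr (by lia))
    rwa [hn] at h5
  | E i hi h j hj =>
    have h5 := isRankSubspace_eSpace hL hj
    rwa [hn] at h5

theorem finrank_summand [CharZero K]
    (hσ : orderOf σ = n) (hn : Module.finrank K L = n) (h2 : 2 ∣ n) (ι : Index σ n) :
    Module.finrank K (summand σ n ι) = summandDim σ n ι := by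
  have hn0 : 0 < n := hσ ▸ orderOf_pos σ
  cases ι with
  | B =>
    have h5 := finrank_A_of_orderOf_eq_two (orderOf_pow_half hσ h2 hn0)
    rwa [hn] at h5
  | A0 =>
    have := finrank_A_of_injective (formMap_one_injective (K := K) (L := L))
    rwa [hn, ← pow_zero σ] at this
  | U i hi h =>
    have h5 := finrank_map_eigenspace_one (formMap_injective (pow_sq_ne_one hσ hi))
      ((σ ^ i) ^ oddPart (σ ^ i))
    rwa [orderOf_pow_oddPart, twoExp_eq_one h.1, hn, pow_one] at h5
  | V i hi h =>
    have h4 := orderOf_pow_oddPart (σ ^ i)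
    rw [twoExp_eq_one h.1, pow_one] at h4
    have h5 := finrank_map_eigenspace_neg_one (formMap_injective (pow_sq_ne_one hσ hi))
      (h4 ▸ even_two)
    rwa [h4, hn] at h5
  | Aodd i hi h =>
    have h5 := finrank_A_of_injective (formMap_injective (pow_sq_ne_one hσ hi))
    rwa [hn] at h5
  | V1 i hi h =>
    have h5 := finrank_map_eigenspace_one (formMap_injective (pow_sq_ne_one hσ hi))
      ((σ ^ i) ^ oddPart (σ ^ i))
    rw [orderOf_pow_oddPart, hn] at h5
    refine h5.trans ?_
    rw [summandDim, ← two_pow_twoExp_mul_oddPart (σ ^ i), mul_comm _ n,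
      Nat.mul_div_mul_right _ _ (odd_oddPart _).pos]
  | V2 i hi h =>
    have h4 := orderOf_pow_oddPart (σ ^ i)
    have h3 := two_le_twoExp h
    have h5 := finrank_map_eigenspace_neg_one (formMap_injective (pow_sq_ne_one hσ hi))
      (h4 ▸ Nat.even_pow.mpr ⟨even_two, by lia⟩)
    rw [h4, hn] at h5
    refine h5.trans ?_
    rw [summandDim, ← two_pow_twoExp_mul_oddPart (σ ^ i), mul_comm _ n,
      Nat.mul_div_mul_right _ _ (odd_oddPart _).pos]
  | E i hi h j hj =>
    have h3 : 2 ^ j ∣ orderOf (σ ^ i) := by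
      rw [← two_pow_twoExp_mul_oddPart]
      exact (pow_dvd_pow 2 (by lia)).mul_right _
    have h4 : orderOf ((σ ^ i) ^ (orderOf (σ ^ i) / 2 ^ j)) = 2 ^ j := by
      have h0 := orderOf_pos (σ ^ i)
      rw [orderOf_pow_of_dvd (Nat.div_pos (Nat.le_of_dvd h0 h3) (by positivity)).ne'
        (Nat.div_dvd_of_dvd h3), Nat.div_div_self h3 h0.ne']
    have h5 := finrank_map_eigenspace_neg_one (formMap_injective (pow_sq_ne_one hσ hi))
      (h4 ▸ Nat.even_pow.mpr ⟨even_two, by lia⟩)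
    rwa [h4, hn] at h5

end GaloisSymForm

/-! ### Independence by fibres, and the dyadic splitting of `L` -/

/-- A vanishing sum is grouped by `π`: each group vanishes by independence of `q`, then each term by
independence inside its fibre. -/
theorem iSupIndep_of_fibers {R M ι κ : Type*} [Ring R] [AddCommGroup M] [Module R M]
    {p : ι → Submodule R M} {q : κ → Submodule R M} (π : ι → κ) (hq : iSupIndep q)
    (hpq : ∀ i, p i ≤ q (π i)) (hp : ∀ k, iSupIndep (fun x : {i // π i = k} => p x)) :
    iSupIndep p := by
  classical
  rw [iSupIndep_iff_finsetSum_eq_zero_imp_eq_zero] at hq ⊢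
  intro s v hv h0 i hi
  have h1 : ∀ k ∈ s.image π, ∑ j ∈ s with π j = k, v j = 0 := by
    refine hq _ (fun k => ∑ j ∈ s with π j = k, v j) (fun k _ => ?_) ?_
    · refine Submodule.sum_mem _ fun j hj => ?_
      rw [Finset.mem_filter] at hj
      exact hj.2 ▸ hpq j (hv j hj.1)
    · rw [Finset.sum_fiberwise_of_maps_to (fun j hj => Finset.mem_image_of_mem π hj), h0]
  have h2 := (iSupIndep_iff_finsetSum_eq_zero_imp_eq_zero _).mp (hp (π i))
    (s.subtype (fun j => π j = π i)) (fun j => v j)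
    (fun j hj => hv j (Finset.mem_subtype.mp hj))
    (by
      rw [Finset.sum_subtype_eq_sum_filter]
      exact h1 _ (Finset.mem_image_of_mem π hi))
  exact h2 ⟨i, rfl⟩ (Finset.mem_subtype.mpr hi)

namespace GaloisSymForm

variable {K L : Type*} [Field K] [Field L] [Algebra K L]

/-- The kernels of `t - 1`, `t + 1`, `t ^ 2 + 1`, `t ^ 4 + 1`, and so on. -/
def dyadicKer (t : L ≃ₐ[K] L) : ℕ → Submodule K L
  | 0 => Module.End.eigenspace t.toLinearMap 1
  | e + 1 => Module.End.eigenspace (t ^ 2 ^ e).toLinearMap (-1)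

theorem pow_apply_of_mem_dyadicKer {t : L ≃ₐ[K] L} {d e : ℕ} (hde : d ≤ e) {x : L}
    (hx : x ∈ dyadicKer t d) : (t ^ 2 ^ e) x = x := by
  cases d with
  | zero => exact pow_apply_eq_self (mem_eigenspace_one_iff.mp hx) _
  | succ d =>
    obtain ⟨c, rfl⟩ := Nat.exists_eq_add_of_le hde
    have hx' := mem_eigenspace_neg_one_iff.mp hx
    have h2 : (t ^ 2 ^ (d + 1)) x = x := by
      rw [pow_succ, pow_mul, sq, AlgEquiv.mul_apply, hx', map_neg, hx', neg_neg]
    rw [pow_add 2, pow_mul]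
    exact pow_apply_eq_self h2 _

/-- In a vanishing sum with top level `e + 1`, `t^{2^e}` negates the top term and fixes all the
others, so twice the top term is zero. -/
theorem iSupIndep_dyadicKer [CharZero L] (t : L ≃ₐ[K] L) : iSupIndep (dyadicKer t) := by
  rw [iSupIndep_iff_finsetSum_eq_zero_imp_eq_zero]
  intro s
  induction s using Finset.induction_on_max with
  | empty => simp
  | insert a s hs ih =>
    intro v hv h0
    have ha : a ∉ s := fun h => lt_irrefl a (hs a h)
    rw [Finset.sum_insert ha] at h0
    have hva : v a = 0 := by
      cases a with
      | zero =>
        have : s = ∅ := Finset.eq_empty_of_forall_notMem fun x hx => absurd (hs x hx) (by simp)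
        simpa [this] using h0
      | succ e =>
        have h1 := mem_eigenspace_neg_one_iff.mp (hv (e + 1) (Finset.mem_insert_self _ _))
        have h2 : (t ^ 2 ^ e) (∑ i ∈ s, v i) = ∑ i ∈ s, v i := by
          rw [map_sum]
          exact Finset.sum_congr rfl fun i hi => pow_apply_of_mem_dyadicKer
            (Nat.lt_succ_iff.mp (hs i hi)) (hv i (Finset.mem_insert_of_mem hi))
        have h3 := congrArg (⇑(t ^ 2 ^ e)) h0
        rw [map_add, h1, h2, map_zero] at h3
        have h4 : (2 : L) * v (e + 1) = 0 := by linear_combination h0 - h3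
        simpa using h4
    rw [hva, zero_add] at h0
    intro i hi
    rcases Finset.mem_insert.mp hi with rfl | hi
    · exact hva
    · exact ih v (fun i hi => hv i (Finset.mem_insert_of_mem hi)) h0 i hi

theorem mem_iSup_dyadicKer_of_pow_apply_eq [CharZero K] (t : L ≃ₐ[K] L) (N : ℕ) {x : L}
    (hx : (t ^ 2 ^ N) x = x) : x ∈ ⨆ e ∈ Finset.range (N + 1), dyadicKer t e := by
  induction N generalizing x with
  | zero =>
    refine Submodule.mem_iSup_of_mem 0 (Submodule.mem_iSup_of_mem (by simp) ?_)
    exact mem_eigenspace_one_iff.mpr (by simpa using hx)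
  | succ N ih =>
    -- Since `t^{2^N}` swaps `x` and `y`, `x + y` falls under the induction hypothesis and `x - y`
    -- lies in level `N + 1`.
    set y := (t ^ 2 ^ N) x with hy
    have hyx : (t ^ 2 ^ N) y = x := by
      rw [hy, ← AlgEquiv.mul_apply, ← sq, ← pow_mul, ← pow_succ, hx]
    have h1 : x + y ∈ ⨆ e ∈ Finset.range (N + 1 + 1), dyadicKer t e := by
      have h := ih (x := x + y) (by rw [map_add, hyx, ← hy, add_comm])
      have hle : (⨆ e ∈ Finset.range (N + 1), dyadicKer t e)
          ≤ ⨆ e ∈ Finset.range (N + 1 + 1), dyadicKer t e :=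
        biSup_mono fun e he => Finset.mem_range.mpr ((Finset.mem_range.mp he).trans (by lia))
      exact hle h
    have h2 : x - y ∈ ⨆ e ∈ Finset.range (N + 1 + 1), dyadicKer t e := by
      refine Submodule.mem_iSup_of_mem (N + 1) (Submodule.mem_iSup_of_mem (by simp) ?_)
      refine mem_eigenspace_neg_one_iff.mpr ?_
      rw [map_sub, hyx, ← hy, neg_sub]
    have h3 : x = (2⁻¹ : K) • (x + y) + (2⁻¹ : K) • (x - y) := by
      rw [← smul_add, add_add_sub_cancel, ← two_smul K x, smul_smul, inv_mul_cancel₀ two_ne_zero,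
        one_smul]
    rw [h3]
    exact Submodule.add_mem _ (Submodule.smul_mem _ _ h1) (Submodule.smul_mem _ _ h2)

theorem minusSpace_eq_map_dyadicKer (s : L ≃ₐ[K] L) :
    minusSpace s = (dyadicKer (s ^ oddPart s) 1).map (formMap s) := by
  rw [minusSpace, dyadicKer, pow_zero, pow_one]

theorem eSpace_eq_map_dyadicKer {s : L ≃ₐ[K] L} {j : ℕ} (hj : j ≤ twoExp s) :
    eSpace s j = (dyadicKer (s ^ oddPart s) (twoExp s - j + 1)).map (formMap s) := by
  have h : orderOf s / 2 ^ j = oddPart s * 2 ^ (twoExp s - j) := by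
    rw [← two_pow_twoExp_mul_oddPart s]
    refine Nat.div_eq_of_eq_mul_left (by positivity) ?_
    rw [mul_assoc, ← pow_add, Nat.sub_add_cancel hj, mul_comm]
  rw [eSpace, dyadicKer, h, pow_mul]

theorem A_le_of_forall_dyadicKer [CharZero K] {s : L ≃ₐ[K] L} {W : Submodule K (Sym K L)}
    (h : ∀ e ≤ twoExp s, (dyadicKer (s ^ oddPart s) e).map (formMap s) ≤ W) : A s ≤ W := by
  rintro _ ⟨b, rfl⟩
  have hb := mem_iSup_dyadicKer_of_pow_apply_eq (s ^ oddPart s) (twoExp s) (x := b)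
    (by rw [← pow_mul, mul_comm, two_pow_twoExp_mul_oddPart, pow_orderOf_eq_one,
          AlgEquiv.one_apply])
  have h2 : (⨆ e ∈ Finset.range (twoExp s + 1), dyadicKer (s ^ oddPart s) e)
      ≤ W.comap (formMap s) := by
    refine iSup₂_le fun e he => ?_
    rw [← Submodule.map_le_iff_le_comap]
    exact h e (Nat.lt_succ_iff.mp (Finset.mem_range.mp he))
  exact h2 hb

end GaloisSymForm

/-! ### Expansion in automorphisms and the direct sum decomposition -/

namespace GaloisSymForm

variable {K L : Type*} [Field K] [Field L] [Algebra K L] {σ : L ≃ₐ[K] L} {n : ℕ}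

open Classical in
/-- The coefficients of `form s b` with respect to the automorphisms. -/
noncomputable def formCoeff (s : L ≃ₐ[K] L) (b : L) : (L ≃ₐ[K] L) → L :=
  Pi.single s b + Pi.single s⁻¹ (s⁻¹ b)

theorem formCoeff_eq_zero {s g : L ≃ₐ[K] L} (h1 : g ≠ s) (h2 : g ≠ s⁻¹) (b : L) :
    formCoeff s b g = 0 := by
  simp [formCoeff, h1, h2]

/-- The exponent of the automorphism underlying a summand. -/
def Index.exponent : Index σ n → ℕ
  | .B => n / 2
  | .A0 => 0
  | .U i _ _ => i
  | .V i _ _ => i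
  | .Aodd i _ _ => i
  | .V1 i _ _ => i
  | .V2 i _ _ => i
  | .E i _ _ _ _ => i

/-- The position of a summand among the dyadic kernels of the automorphism underlying it. -/
noncomputable def Index.level : Index σ n → ℕ
  | .B => 0
  | .A0 => 0
  | .U _ _ _ => 0
  | .V _ _ _ => 1
  | .Aodd _ _ _ => 0
  | .V1 _ _ _ => 0
  | .V2 _ _ _ => 1
  | .E i _ _ j _ => twoExp (σ ^ i) - j + 1

theorem Index.exponent_le (ι : Index σ n) : ι.exponent ≤ n / 2 := by
  cases ι <;> simp only [Index.exponent] <;> lia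

theorem map_formMap_le_A (s : L ≃ₐ[K] L) (W : Submodule K L) : W.map (formMap s) ≤ A s :=
  LinearMap.map_le_range

theorem summand_le_A (ι : Index σ n) : summand σ n ι ≤ A (σ ^ ι.exponent) := by
  cases ι
  case B => exact le_rfl
  case A0 => exact le_rfl
  case Aodd => exact le_rfl
  all_goals exact map_formMap_le_A _ _

theorem summand_eq_map_dyadicKer {ι : Index σ n} (h : 1 ≤ ι.exponent ∧ ι.exponent < n / 2) :
    summand σ n ι = (dyadicKer ((σ ^ ι.exponent) ^ oddPart (σ ^ ι.exponent)) ι.level).map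
      (formMap (σ ^ ι.exponent)) := by
  cases ι with
  | B => exact absurd h.2 (lt_irrefl _)
  | A0 => exact absurd h.1 (by simp [Index.exponent])
  | U i hi h => rfl
  | V i hi h => exact minusSpace_eq_map_dyadicKer _
  | Aodd i hi hodd =>
    exact A_eq_plusSpace (by rw [oddPart_eq_orderOf (Nat.odd_iff.mpr hodd), pow_orderOf_eq_one])
  | V1 i hi h => rfl
  | V2 i hi h => exact minusSpace_eq_map_dyadicKer _
  | E i hi h j hj => exact eSpace_eq_map_dyadicKer (by lia)

/-- The order of `σ^i` modulo `4` fixes the family of labels, and within it the levels `0`, `1` and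
`β - j + 1 ≥ 2` are distinct. -/
theorem Index.ext_of_exponent_of_level {ι κ : Index σ n} (h1 : ι.exponent = κ.exponent)
    (h2 : ι.level = κ.level) (hn : 2 ≤ n) : ι = κ := by
  cases ι <;> cases κ <;> simp only [Index.exponent, Index.level] at h1 h2 <;>
    first
    | rfl
    | (subst h1; unfold Nat.ModEq at *; first | rfl | (exfalso; lia) | (congr; lia))
    | (exfalso; lia)

theorem Index.eq_of_exponent_eq_of_not_mem {ι κ : Index σ n} (h1 : ι.exponent = κ.exponent)
    (h2 : ¬ (1 ≤ ι.exponent ∧ ι.exponent < n / 2)) (hn : 2 ≤ n) : ι = κ := by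
  cases ι <;> cases κ <;> simp only [Index.exponent] at h1 h2 <;>
    first
    | rfl
    | (exfalso; lia)

variable [FiniteDimensional K L]

/-- The bilinear form `(x, y) ↦ Tr (∑ g, c g * g x * y)` attached to a family of coefficients. -/
noncomputable def coeffForm : ((L ≃ₐ[K] L) → L) →ₗ[K] LinearMap.BilinForm K L where
  toFun c := Algebra.traceForm K L ∘ₗ ∑ g, LinearMap.mulLeft K (c g) ∘ₗ g.toLinearMap
  map_add' c d := by
    ext x y
    simp [add_mul, Finset.sum_add_distrib, LinearMap.sum_apply]
  map_smul' a c := by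
    ext x y
    simp [LinearMap.sum_apply, Finset.smul_sum, ← Finset.mul_sum]

theorem coeffForm_apply (c : (L ≃ₐ[K] L) → L) (x y : L) :
    coeffForm c x y = Algebra.trace K L ((∑ g, c g * g x) * y) := by
  simp [coeffForm, LinearMap.sum_apply, Algebra.traceForm_apply, Finset.sum_mul]

theorem coeffForm_formCoeff (s : L ≃ₐ[K] L) (b : L) :
    coeffForm (formCoeff s b) = (form s b : LinearMap.BilinForm K L) := by
  classical
  ext x y
  rw [coeffForm_apply, form_apply]
  congr 2
  simp only [formCoeff, Pi.add_apply, add_mul, Finset.sum_add_distrib, Pi.single_apply, ite_mul,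
    zero_mul, Finset.sum_ite_eq', Finset.mem_univ, if_true]
  rw [← map_mul, add_comm]
  rfl

/-- Passing from `(s, b)` to `(s⁻¹, s⁻¹(b))` only exchanges the two coefficients of the form. -/
theorem A_le_A_inv (s : L ≃ₐ[K] L) : A s ≤ A s⁻¹ := by
  rintro _ ⟨b, rfl⟩
  refine ⟨s⁻¹ b, Subtype.ext ?_⟩
  change (form s⁻¹ (s⁻¹ b) : LinearMap.BilinForm K L) = form s b
  have h : s (s⁻¹ b) = b := s.apply_symm_apply b
  rw [← coeffForm_formCoeff, ← coeffForm_formCoeff, formCoeff, formCoeff, inv_inv, h, add_comm]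

theorem A_pow_le_iSup_summand [CharZero K] (hσ : orderOf σ = n) {i : ℕ} (hi : i ≤ n / 2) :
    A (σ ^ i) ≤ ⨆ ι, summand σ n ι := by
  rcases Nat.eq_zero_or_pos i with rfl | hi0
  · exact le_iSup (summand σ n) .A0
  rcases hi.eq_or_lt with rfl | hlt
  · exact le_iSup (summand σ n) .B
  have hi' : 1 ≤ i ∧ i < n / 2 := ⟨hi0, hlt⟩
  have hord : orderOf (σ ^ i) ≠ 2 := fun h =>
    pow_sq_ne_one hσ hi' (by rw [← h, pow_orderOf_eq_one])
  by_cases hodd : orderOf (σ ^ i) ≡ 1 [MOD 2]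
  · exact le_iSup (summand σ n) (.Aodd i hi' hodd)
  have hmod : orderOf (σ ^ i) ≡ 2 [MOD 4] ∨ orderOf (σ ^ i) ≡ 0 [MOD 4] := by
    unfold Nat.ModEq at *
    lia
  refine A_le_of_forall_dyadicKer fun e he => ?_
  rcases hmod with h | h
  · rw [twoExp_eq_one h] at he
    interval_cases e
    · exact le_iSup (summand σ n) (.U i hi' ⟨h, hord⟩)
    · rw [← minusSpace_eq_map_dyadicKer]
      exact le_iSup (summand σ n) (.V i hi' ⟨h, hord⟩)
  · rcases e with _ | _ | e
    · exact le_iSup (summand σ n) (.V1 i hi' h)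
    · rw [zero_add, ← minusSpace_eq_map_dyadicKer]
      exact le_iSup (summand σ n) (.V2 i hi' h)
    · have hE := eSpace_eq_map_dyadicKer (s := σ ^ i) (j := twoExp (σ ^ i) - (e + 1)) (by lia)
      rw [Nat.sub_sub_self (by lia)] at hE
      rw [← hE]
      exact le_iSup (summand σ n) (.E i hi' h (twoExp (σ ^ i) - (e + 1)) (by lia))

variable [IsGalois K L]

theorem coeffForm_injective : Function.Injective (coeffForm (K := K) (L := L)) := by
  rw [injective_iff_map_eq_zero]
  intro c hc
  have h := Fintype.linearIndependent_iff.mp (linearIndependent_algEquiv (K := K) (L := L)) c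
  refine funext (h ?_)
  ext x
  refine (traceForm_nondegenerate K L).1 _ fun y => ?_
  have := coeffForm_apply c x y
  rw [hc, LinearMap.zero_apply, LinearMap.zero_apply] at this
  rw [Algebra.traceForm_apply, this]
  simp [LinearMap.sum_apply]

/-- Both sides have dimension `[L : K]²`, so injectivity suffices. -/
theorem coeffForm_surjective : Function.Surjective (coeffForm (K := K) (L := L)) := by
  have h : Module.finrank K ((L ≃ₐ[K] L) → L)
      = Module.finrank K (LinearMap.BilinForm K L) := by
    rw [Module.finrank_pi_fintype, Module.finrank_linearMap, Module.finrank_linearMap,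
      Finset.sum_const, Finset.card_univ, ← Nat.card_eq_fintype_card, IsGalois.card_aut_eq_finrank,
      Module.finrank_self, mul_one, smul_eq_mul]
  let _ : AddCommGroup (LinearMap.BilinForm K L) := Module.addCommMonoidToAddCommGroup K
  exact (LinearMap.injective_iff_surjective_of_finrank_eq_finrank h).mp coeffForm_injective

theorem iSup_A [CharZero K] : ⨆ s : L ≃ₐ[K] L, A s = ⊤ := by
  rw [eq_top_iff]
  rintro φ -
  obtain ⟨c, hc⟩ := coeffForm_surjective (φ : LinearMap.BilinForm K L)
  have h : φ = ∑ g, formMap g ((2⁻¹ : K) • c g) := by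
    have h2 : (2 : K) • φ = ∑ g, formMap g (c g) := by
      ext x y
      have hs : (φ : LinearMap.BilinForm K L) x y = (φ : LinearMap.BilinForm K L) y x :=
        φ.2.eq x y
      rw [two_smul]
      simp only [Submodule.coe_add, LinearMap.add_apply, AddSubmonoidClass.coe_finsetSum,
        LinearMap.sum_apply]
      -- Writing `2φ(x, y)` as `φ(x, y) + φ(y, x)` symmetrizes the `g`-term of the expansion into
      -- `φ_{c(g), g}`.
      nth_rw 2 [hs]
      rw [← hc, coeffForm_apply, coeffForm_apply, ← map_add, Finset.sum_mul, Finset.sum_mul,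
        ← Finset.sum_add_distrib, map_sum]
      refine Finset.sum_congr rfl fun g _ => ?_
      change _ = Algebra.trace K L (c g * (x * g y + g x * y))
      congr 1
      ring
    simp only [map_smul, ← Finset.smul_sum, ← h2]
    rw [smul_smul, inv_mul_cancel₀ two_ne_zero, one_smul]
  rw [h]
  exact Submodule.sum_mem _ fun g _ => Submodule.mem_iSup_of_mem g ⟨_, rfl⟩

theorem iSupIndep_A_pow (hσ : orderOf σ = n) :
    iSupIndep (fun i : {i : ℕ // i ≤ n / 2} => A (σ ^ (i : ℕ))) := by
  have hn0 : 0 < n := hσ ▸ orderOf_pos σ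
  rw [iSupIndep_iff_finsetSum_eq_zero_imp_eq_zero]
  intro s v hv h0 i hi
  have hv' : ∀ j, ∃ b, j ∈ s → v j = form (σ ^ (j : ℕ)) b := fun j => by
    by_cases hj : j ∈ s
    · obtain ⟨b, hb⟩ := hv j hj
      exact ⟨b, fun _ => hb.symm⟩
    · exact ⟨0, fun h => absurd h hj⟩
  choose b hb using hv'
  have h1 : ∑ j ∈ s, formCoeff (σ ^ (j : ℕ)) (b j) = 0 := by
    refine coeffForm_injective ?_
    rw [map_sum, map_zero]
    have : ∀ j ∈ s, coeffForm (formCoeff (σ ^ (j : ℕ)) (b j))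
        = (v j : LinearMap.BilinForm K L) := fun j hj => by
      rw [hb j hj, coeffForm_formCoeff]
    rw [Finset.sum_congr rfl this, ← AddSubmonoidClass.coe_finsetSum, h0]
    rfl
  have hpow : ∀ j l : ℕ, j ≤ n / 2 → l ≤ n / 2 → σ ^ j = σ ^ l → j = l := fun j l hj hl h =>
    pow_injOn_Iio_orderOf (Set.mem_Iio.mpr (by lia)) (Set.mem_Iio.mpr (by lia)) h
  -- Here `n` divides `j + l ≤ n`, so `j + l` is `0` or `n`, and either value forces `j = l`.
  have hpow' : ∀ j l : ℕ, j ≤ n / 2 → l ≤ n / 2 → σ ^ j = (σ ^ l)⁻¹ → j = l := fun j l hj hl h => by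
    rw [eq_inv_iff_mul_eq_one, ← pow_add] at h
    obtain ⟨c, hc⟩ := orderOf_dvd_of_pow_eq_one h
    rw [hσ] at hc
    rcases c with _ | _ | c
    · lia
    · lia
    · have : n * (c + 1 + 1) = n * c + 2 * n := by ring
      have := Nat.zero_le (n * c)
      lia
  rw [hb i hi]
  refine Subtype.ext ?_
  rw [← coeffForm_formCoeff]
  -- The coefficients vanish, not necessarily `b i`: for the involution a nonzero `b` can give the
  -- zero form.
  have h2 : formCoeff (σ ^ (i : ℕ)) (b i) = 0 := by
    funext g
    by_cases hg : g = σ ^ (i : ℕ) ∨ g = (σ ^ (i : ℕ))⁻¹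
    · have h3 := congrFun h1 g
      rw [Finset.sum_apply, Finset.sum_eq_single_of_mem i hi] at h3
      · exact h3
      · intro j _ hji
        have hne : (i : ℕ) ≠ j := fun h => hji (Subtype.ext h.symm)
        rcases hg with rfl | rfl
        · exact formCoeff_eq_zero (fun h => hne (hpow _ _ i.2 j.2 h))
            (fun h => hne (hpow' _ _ i.2 j.2 h)) _
        · exact formCoeff_eq_zero (fun h => hne (hpow' _ _ j.2 i.2 h.symm).symm)
            (fun h => hne (hpow _ _ i.2 j.2 (inv_injective h))) _
    · rw [not_or] at hg
      exact formCoeff_eq_zero hg.1 hg.2 _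
  rw [h2, map_zero]
  rfl

theorem iSupIndep_summand [CharZero K] (hσ : orderOf σ = n) (hn : 2 ≤ n) :
    iSupIndep (summand σ n) := by
  have : CharZero L := charZero_of_injective_algebraMap (algebraMap K L).injective
  refine iSupIndep_of_fibers (fun ι : Index σ n => (⟨ι.exponent, ι.exponent_le⟩ :
    {i : ℕ // i ≤ n / 2})) (iSupIndep_A_pow hσ) summand_le_A fun k => ?_
  by_cases hk : 1 ≤ (k : ℕ) ∧ (k : ℕ) < n / 2
  · have h1 := LinearMap.iSupIndep_map (formMap (σ ^ (k : ℕ)))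
      (formMap_injective (pow_sq_ne_one hσ hk))
      (iSupIndep_dyadicKer ((σ ^ (k : ℕ)) ^ oddPart (σ ^ (k : ℕ))))
    refine (h1.comp (f := fun ι : {ι : Index σ n // _} => ι.1.level) ?_).mono ?_
    · rintro ⟨ι, hι⟩ ⟨κ, hκ⟩ h
      refine Subtype.ext (Index.ext_of_exponent_of_level ?_ h hn)
      rw [Subtype.ext_iff] at hι hκ
      exact hι.trans hκ.symm
    · rintro ⟨ι, rfl⟩
      exact (summand_eq_map_dyadicKer hk).le
  -- The exponents `0` and `n / 2` each carry a single label.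
  · have : Subsingleton {ι : Index σ n // (⟨ι.exponent, ι.exponent_le⟩ :
        {i : ℕ // i ≤ n / 2}) = k} := by
      refine ⟨?_⟩
      rintro ⟨ι, rfl⟩ ⟨κ, hκ⟩
      rw [Subtype.ext_iff] at hκ
      exact Subtype.ext (Index.eq_of_exponent_eq_of_not_mem hκ.symm hk hn)
    exact iSupIndep_subsingleton _

theorem iSup_summand [CharZero K] (hσ : orderOf σ = n)
    (hgen : ∀ τ : L ≃ₐ[K] L, τ ∈ Subgroup.zpowers σ) : ⨆ ι, summand σ n ι = ⊤ := by
  rw [eq_top_iff, ← iSup_A]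
  refine iSup_le fun s => ?_
  obtain ⟨j, hj⟩ := (mem_powers_iff_mem_zpowers.mpr (hgen s))
  have hn0 : 0 < n := hσ ▸ orderOf_pos σ
  have hs : s = σ ^ (j % n) := by rw [← hσ, pow_mod_orderOf]; exact hj.symm
  have hlt := Nat.mod_lt j hn0
  rcases Nat.lt_or_ge (n / 2) (j % n) with h | h
  · have hinv : s⁻¹ = σ ^ (n - j % n) := by
      rw [inv_eq_iff_mul_eq_one, hs, ← pow_add, Nat.add_sub_cancel' hlt.le, ← hσ,
        pow_orderOf_eq_one]
    refine (A_le_A_inv s).trans ?_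
    rw [hinv]
    exact A_pow_le_iSup_summand hσ (by lia)
  · rw [hs]
    exact A_pow_le_iSup_summand hσ h

theorem isInternal_summand [CharZero K] (hσ : orderOf σ = n) (hn : 2 ≤ n)
    (hgen : ∀ τ : L ≃ₐ[K] L, τ ∈ Subgroup.zpowers σ) :
    DirectSum.IsInternal (summand σ n) := by
  rw [DirectSum.isInternal_submodule_iff_iSupIndep_and_iSup_eq_top]
  exact ⟨iSupIndep_summand hσ hn, iSup_summand hσ hgen⟩

end GaloisSymForm

/-! ### A cyclic extension in which `-1` stays a nonsquare -/

namespace GaloisSymForm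

section CyclicExtension

open NumberField Polynomial IntermediateField

theorem minpoly_natDegree_of_linearDisjoint  {F M E : Type*} [Field F] [Field M] [Field E]
    [Algebra F M] [Algebra F E] [Algebra M E] [IsScalarTower F M E] {z : E} (hz : IsIntegral F z)
    (H : (IntermediateField.adjoin F {z}).LinearDisjoint M) :
    (minpoly M z).natDegree = (minpoly F z).natDegree := by
  have : FiniteDimensional F F⟮z⟯ := IntermediateField.adjoin.finiteDimensional hz
  have h1 := H.adjoin_rank_eq_rank_left_of_isAlgebraic (Or.inl inferInstance)
  have h2 : IntermediateField.adjoin M (F⟮z⟯ : Set E) = M⟮z⟯ := by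
    apply le_antisymm
    · rw [IntermediateField.adjoin_le_iff]
      have : F⟮z⟯ ≤ (M⟮z⟯).restrictScalars F := by
        rw [IntermediateField.adjoin_simple_le_iff]
        exact IntermediateField.mem_adjoin_simple_self M z
      exact this
    · rw [IntermediateField.adjoin_simple_le_iff]
      exact IntermediateField.subset_adjoin M _ (IntermediateField.mem_adjoin_simple_self F z)
  rw [h2] at h1
  have h3 := congrArg Cardinal.toNat h1
  change Module.finrank M M⟮z⟯ = Module.finrank F F⟮z⟯ at h3
  rwa [IntermediateField.adjoin.finrank hz, IntermediateField.adjoin.finrank hz.tower_top] at h3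

/-- The discriminant of `ℚ(ζ_p)` is, up to sign, a power of `p`, hence coprime to that of `M`. As
`ℚ(ζ_p)` is Galois, it is linearly disjoint from `M`, so `ζ_p` keeps its degree over `M`. -/
theorem irreducible_cyclotomic_of_not_dvd_discr (M : Type u) [Field M] [NumberField M] (p : ℕ)
    [Fact p.Prime] (hp : ¬ (p : ℤ) ∣ discr M) : Irreducible (cyclotomic p M) := by
  let E := CyclotomicField p M
  have : NumberField E := IsCyclotomicExtension.numberField {p} M E
  have hz := IsCyclotomicExtension.zeta_spec p M E
  set z := IsCyclotomicExtension.zeta p M E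
  have : IsCyclotomicExtension {p} ℚ ℚ⟮z⟯ := hz.intermediateField_adjoin_isCyclotomicExtension ℚ
  have : IsGalois ℚ ℚ⟮z⟯ := IsCyclotomicExtension.isGalois {p} ℚ _
  have hdisj : (ℚ⟮z⟯).LinearDisjoint M := by
    have h1 : IsCoprime (discr ℚ⟮z⟯) (discr (IsScalarTower.toAlgHom ℚ M E).fieldRange) := by
      have h0 : discr M = discr (IsScalarTower.toAlgHom ℚ M E).fieldRange :=
        discr_eq_discr_of_algEquiv M (AlgEquiv.ofInjectiveField (IsScalarTower.toAlgHom ℚ M E))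
      rw [← h0, IsCyclotomicExtension.Rat.discr_prime p]
      have : IsCoprime (p : ℤ) (discr M) :=
        (Nat.prime_iff_prime_int.mp (Fact.out : p.Prime)).coprime_iff_not_dvd.mpr hp
      exact (isCoprime_mul_unit_left_left (isUnit_neg_one.pow _) _ _).mpr this.pow_left
    have h2 := linearDisjoint_of_isGalois_isCoprime_discr E _ _ h1
    have h3 : (IntermediateField.val ℚ⟮z⟯).fieldRange.LinearDisjoint M := h2.symm.symm'
    rwa [IntermediateField.fieldRange_val] at h3
  have hd := minpoly_natDegree_of_linearDisjoint (Algebra.IsIntegral.isIntegral z) hdisj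
  have hp0 : 0 < p := (Fact.out : p.Prime).pos
  rw [← cyclotomic_eq_minpoly_rat hz hp0, natDegree_cyclotomic] at hd
  have hdvd : minpoly M z ∣ cyclotomic p M := minpoly.dvd _ _ (by
    rw [aeval_def, eval₂_eq_eval_map, map_cyclotomic]
    exact (isRoot_cyclotomic_iff.mpr hz))
  rw [eq_of_monic_of_dvd_of_natDegree_le (minpoly.monic (Algebra.IsIntegral.isIntegral z))
    (cyclotomic.monic p M) hdvd (by rw [hd, natDegree_cyclotomic])]
  exact minpoly.irreducible (Algebra.IsIntegral.isIntegral z)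

theorem isPrimitiveRoot_four_iff {F : Type*} [Field F] [CharZero F] {i : F} :
    IsPrimitiveRoot i 4 ↔ -1 = i * i := by
  constructor
  · intro h
    have h4 : (i ^ 2 - 1) * (i ^ 2 + 1) = 0 := by
      linear_combination h.pow_eq_one
    rcases mul_eq_zero.mp h4 with h2 | h2
    · exact absurd (sub_eq_zero.mp h2) (h.pow_ne_one_of_pos_of_lt two_ne_zero (by norm_num))
    · linear_combination -h2
  · intro h
    rw [show 4 = orderOf i from (orderOf_eq_prime_pow (p := 2) (n := 1) ?_ ?_).symm]
    · exact IsPrimitiveRoot.orderOf i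
    · rw [pow_one, sq, ← h]
      norm_num
    · linear_combination (i * i - 1) * (-h)

/-- If `F = K(ζ_p)` contained `i`, then `K(i)`, of degree at least `2` over `K`, would embed in `F`.
As `ζ_p` has degree `φ(p)` over `K(i)`, this gives `[F : K] ≥ 2 φ(p)`, while `[F : K] = φ(p)`. -/
theorem not_isSquare_neg_one_cyclotomic {K F : Type*} [Field K] [NumberField K] [Field F]
    [Algebra K F] [FiniteDimensional K F]
    (hK : ¬ IsSquare (-1 : K)) (p : ℕ) [Fact p.Prime] [IsCyclotomicExtension {p} K F]
    (hirr : Irreducible (cyclotomic p (CyclotomicField 4 K))) : ¬ IsSquare (-1 : F) := by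
  rintro ⟨i, hi⟩
  have : CharZero F := charZero_of_injective_algebraMap (algebraMap K F).injective
  let M := CyclotomicField 4 K
  have : CharZero M := charZero_of_injective_algebraMap (algebraMap K M).injective
  have : FiniteDimensional K M := IsCyclotomicExtension.finiteDimensional {4} K M
  obtain ⟨f⟩ : Nonempty (M →ₐ[K] F) := by
    obtain ⟨e⟩ := IsCyclotomicExtension.nonempty_algEquiv_adjoin_of_exists_isPrimitiveRoot {4} K M F
      (by
        intro m hm _
        rw [Set.mem_singleton_iff] at hm
        exact ⟨i, hm ▸ isPrimitiveRoot_four_iff.mpr hi⟩)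
    exact ⟨(IntermediateField.val _).comp e.toAlgHom⟩
  let _ : Algebra M F := f.toRingHom.toAlgebra
  have : IsScalarTower K M F := IsScalarTower.of_algebraMap_eq fun x => (f.commutes x).symm
  have : FiniteDimensional M F := FiniteDimensional.right K M F
  have hM : Module.finrank K M ≠ 1 := by
    intro h1
    obtain ⟨x, hx⟩ := Algebra.mem_bot.mp ((Subalgebra.bot_eq_top_iff_finrank_eq_one.mpr h1).ge
      (Algebra.mem_top (x := IsCyclotomicExtension.zeta 4 K M)))
    have h2 := isPrimitiveRoot_four_iff.mp (IsCyclotomicExtension.zeta_spec 4 K M)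
    rw [← hx] at h2
    refine hK ⟨x, (algebraMap K M).injective ?_⟩
    rw [map_neg, map_one, map_mul]
    exact h2
  have hz := IsCyclotomicExtension.zeta_spec p K F
  have hp0 : 0 < p := (Fact.out : p.Prime).pos
  have h1 := minpoly.natDegree_le (A := M) (IsCyclotomicExtension.zeta p K F)
  rw [← hz.minpoly_eq_cyclotomic_of_irreducible hirr, natDegree_cyclotomic] at h1
  have hirrK : Irreducible (cyclotomic p K) := by
    refine (cyclotomic.monic p K).irreducible_of_irreducible_map (algebraMap K M) _ ?_
    rwa [map_cyclotomic]
  have h2 := IsCyclotomicExtension.finrank F hirrK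
  have h3 := Module.finrank_mul_finrank K M F
  have h4 : 0 < Module.finrank K M := Module.finrank_pos
  have h5 : 0 < p.totient := Nat.totient_pos.mpr hp0
  have h6 : 2 ≤ Module.finrank K M := by lia
  nlinarith

theorem exists_cyclic_extension (K : Type u) [Field K] [NumberField K]
    (hK : ¬ IsSquare (-1 : K)) {n : ℕ} (hn : n ≠ 0) :
    ∃ (L : Type u) (_ : Field L) (_ : Algebra K L) (_ : FiniteDimensional K L)
      (_ : IsGalois K L),
      Module.finrank K L = n ∧ IsCyclic (L ≃ₐ[K] L) ∧ ¬ IsSquare (-1 : L) := by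
  let M := CyclotomicField 4 K
  have : NumberField M := IsCyclotomicExtension.numberField {4} K M
  obtain ⟨p, hp, hlt, hmod⟩ := Nat.exists_prime_gt_modEq_one (discr M).natAbs hn
  have : Fact p.Prime := ⟨hp⟩
  have hdvd : ¬ (p : ℤ) ∣ discr M := by
    rw [Int.natCast_dvd]
    exact fun h => hlt.not_ge (Nat.le_of_dvd (Int.natAbs_pos.mpr (discr_ne_zero M)) h)
  have hirr : Irreducible (cyclotomic p M) := irreducible_cyclotomic_of_not_dvd_discr M p hdvd
  have hirrK : Irreducible (cyclotomic p K) := by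
    refine (cyclotomic.monic p K).irreducible_of_irreducible_map (algebraMap K M) _ ?_
    rwa [map_cyclotomic]
  let F := CyclotomicField p K
  have : FiniteDimensional K F := IsCyclotomicExtension.finiteDimensional {p} K F
  have : IsGalois K F := IsCyclotomicExtension.isGalois {p} K F
  have hF : ¬ IsSquare (-1 : F) := not_isSquare_neg_one_cyclotomic hK p hirr
  have hcyc : IsCyclic (F ≃ₐ[K] F) :=
    isCyclic_of_surjective _ (IsCyclotomicExtension.autEquivPow F hirrK).symm.surjective
  have hcard : Nat.card (F ≃ₐ[K] F) = p - 1 := by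
    rw [IsGalois.card_aut_eq_finrank, IsCyclotomicExtension.finrank F hirrK, Nat.totient_prime hp]
  have hnp : n ∣ p - 1 := (Nat.modEq_iff_dvd' hp.one_le).mp hmod.symm
  obtain ⟨g, hg⟩ := IsCyclic.exists_ofOrder_eq_natCard (α := F ≃ₐ[K] F)
  rw [hcard] at hg
  -- The group is cyclic of order `p - 1`, divisible by `n`, so this subgroup has index `n` and its
  -- fixed field has degree `n`.
  let H := Subgroup.zpowers (g ^ n)
  have : H.Normal := ⟨fun a ha b => by
    have : IsMulCommutative (F ≃ₐ[K] F) := inferInstance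
    rwa [mul_comm' b a, mul_inv_cancel_right]⟩
  have hidx : H.index = n := by
    have h1 := H.card_mul_index
    rw [Nat.card_zpowers, orderOf_pow_of_dvd hn (hg ▸ hnp), hcard, hg] at h1
    have h2 : 0 < p - 1 := by have := hp.two_le; lia
    have h3 := Nat.div_mul_cancel hnp
    refine Nat.eq_of_mul_eq_mul_left (Nat.div_pos (Nat.le_of_dvd h2 hnp) (Nat.pos_of_ne_zero hn)) ?_
    rw [h1, h3]
  let L := IntermediateField.fixedField H
  have hgal : IsGalois K L := IsGalois.of_fixedField_normal_subgroup H
  refine ⟨L, inferInstance, inferInstance, inferInstance, hgal, ?_, ?_, ?_⟩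
  · rw [IntermediateField.finrank_eq_fixingSubgroup_index, IntermediateField.fixingSubgroup_fixedField,
      hidx]
  · exact isCyclic_of_surjective _ (AlgEquiv.restrictNormalHom_surjective (F := K) (K₁ := L) F)
  · rintro ⟨x, hx⟩
    refine hF ⟨(x : F), ?_⟩
    simpa using congrArg (algebraMap L F) hx

end CyclicExtension

end GaloisSymForm

theorem mainTheorem9 (K : Type u) [Field K] [NumberField K]
    (hK : ¬ IsSquare (-1 : K))
    (n α k : ℕ) (hα : 2 ≤ α) (hk : Odd k) (hn : n = 2 ^ α * k) :
    ∃ (L : Type u) (_ : Field L) (_ : Algebra K L) (_ : FiniteDimensional K L)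
      (_ : IsGalois K L),
      Module.finrank K L = n ∧ IsCyclic (L ≃ₐ[K] L) ∧
      ∀ σ : L ≃ₐ[K] L, (∀ τ : L ≃ₐ[K] L, τ ∈ Subgroup.zpowers σ) →
        DirectSum.IsInternal (GaloisSymForm.summand σ n) ∧
        (∀ ι : GaloisSymForm.Index σ n, GaloisSymForm.IsRankSubspace (GaloisSymForm.summandRank σ n ι) (GaloisSymForm.summand σ n ι)) ∧
        (∀ ι : GaloisSymForm.Index σ n, Module.finrank K (GaloisSymForm.summand σ n ι) = GaloisSymForm.summandDim σ n ι) := by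
  have hn4 : n = 4 * (2 ^ (α - 2) * k) := by
    obtain ⟨c, rfl⟩ := Nat.exists_eq_add_of_le hα
    rw [hn, Nat.add_sub_cancel_left, pow_add]
    ring
  have hn0 : n ≠ 0 := by
    rw [hn]
    exact mul_ne_zero (by positivity) hk.pos.ne'
  obtain ⟨L, _, _, _, _, hfin, hcyc, hL⟩ := GaloisSymForm.exists_cyclic_extension K hK hn0
  refine ⟨L, inferInstance, inferInstance, inferInstance, inferInstance, hfin, hcyc, ?_⟩
  intro σ hgen
  have hσ : orderOf σ = n := by
    rw [orderOf_eq_card_of_forall_mem_zpowers hgen, IsGalois.card_aut_eq_finrank, hfin]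
  exact ⟨GaloisSymForm.isInternal_summand hσ (by lia) hgen,
    GaloisSymForm.isRankSubspace_summand hL hσ hfin (by lia),
    GaloisSymForm.finrank_summand hσ hfin (by lia)⟩
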